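/- Let $a\in\mathbb R$, $a<b\le\infty$, and $m\in\mathbb N$. **Spaces.** A function on $[a,b)$ is locally $HK$ integrable if it is Henstock–Kurzweil integrable on every compact subinterval of $[a,b)$. $HK_{loc}([a,b))$ is the set of locally $HK$ integrable functions $[a,b)\to\mathbb R$, a.e. equal functions being identified, ordered by the a.e. pointwise order. $\mathcal D^{lr}([a,b))$ is the set of locally $HK$ integrable $H:[a,b)\to\mathbb R$ that have a finite left limit at every point of $(a,b)$ and a finite right limit at $a$; $\mathcal D^{lc}([a,b))$ is the set of those that are moreover left continuous on $(a,b)$ and right continuous at $a$, ordered pointwise; $\mathcal D^{lc}_0([a,b))$ is the set of $F\in\mathcal D^{lc}([a,b))$ with $F(a+)=0$. Products carry the componentwise order. A distribution $f$ on $(a,b)$ is the distributional derivative $H'$ of $H\in\mathcal D^{lr}([a,b))$, and $H$ is a primitive of $f$, if $\langle f,\varphi\rangle=-\int H\varphi'$ (Henstock–Kurzweil integral) for all $\varphi\in C_c^\infty((a,b))$. $\mathcal A_D([a,b))$ is the set of distributions on $(a,b)$ with a primitive in $\mathcal D^{lr}([a,b))$; each $f\in\mathcal A_D([a,b))$ has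 exactly one primitive $\mathcal F(f)$ in $\mathcal D^{lc}_0([a,b))$, and $f\preceq g$ means $\mathcal F(f)\le\mathcal F(g)$ pointwise on $[a,b)$. **System.** For maps $f_i: HK_{loc}([a,b))^m\to\mathcal A_D([a,b))$ and $c_i\in\mathbb R$, $i=1,\dots,m$, consider $$y_i'=f_i(y_1,\dots,y_m),\qquad y_i(a)=c_i,\qquad i=1,\dots,m. \tag{1}$$ A function $y\in\mathcal D^{lc}([a,b))^m$ is a subsolution of (1) if $y_i'\preceq f_i(y)$ and $y_i(a)\le c_i$ for every $i$, a supersolution if the reversed inequalities hold, and a solution if equalities hold. The map $f_i$ is increasing if $f_i(x)\preceq f_i(z)$ whenever $x\le z$ in $HK_{loc}([a,b))^m$. **Theorem 5.1.** Assume that each $f_i$ is increasing, that (1) has in $\mathcal D^{lc}([a,b))^m$ a subsolution $\underline y$ and a supersolution $\overline y$, and that $\underline y\le\overline y$. Then among the solutions of (1) in the order interval $[\underline y,\overline y]$ of $\mathcal D^{lc}([a,b))^m$ there are a smallest one $y_*$ and a greatest one $y^*$. Moreover $y_*$ and $y^*$ are increasing with respect to $f_i$ and $c_i$: if $\hat f_i$,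 $\hat c_i$, $i=1,\dots,m$, are further data satisfying the above hypotheses with the same $\underline y$ and $\overline y$, if $f_i(x)\preceq\hat f_i(x)$ for all $x\in HK_{loc}([a,b))^m$ and $c_i\le\hat c_i$ for all $i$, and if $\hat y_*$, $\hat y^*$ are the smallest and greatest solutions in $[\underline y,\overline y]$ of the system with data $\hat f_i,\hat c_i$, then $y_*\le\hat y_*$ and $y^*\le\hat y^*$. -/

import Mathlib

open MeasureTheory Filter Topology
open scoped Distributions

namespace DistribCauchy

noncomputable section

/-! ### The Henstock–Kurzweil integral on a compact interval -/

/-- The interval from `c` to `d`, as a one-dimensional box. -/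
def hkBox (c d : ℝ) (h : c < d) : BoxIntegral.Box (Fin 1) where
  lower := fun _ => c
  upper := fun _ => d
  lower_lt_upper := fun _ => h

/-- `g` is Henstock–Kurzweil integrable on `[c, d]` (where `c < d`) with integral `J`. -/
def HasHKIntegral (g : ℝ → ℝ) (c d J : ℝ) : Prop :=
  ∃ h : c < d, BoxIntegral.HasIntegral (hkBox c d h) BoxIntegral.IntegrationParams.Henstock
    (fun x : Fin 1 → ℝ => g (x 0)) (volume : Measure (Fin 1 → ℝ)).toBoxAdditive.toSMul J

/-! ### The interval `[a, b)`, where `b ≤ ∞`, and functions on it -/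

/-- The half-open interval `[a, b)`. -/
def HalfOpen (a : ℝ) (b : EReal) : Set ℝ := {t | a ≤ t ∧ (t : EReal) < b}

/-- The interior `(a, b)` of `[a, b)`. -/
def openInterval (a : ℝ) (b : EReal) : TopologicalSpace.Opens ℝ where
  carrier := {t | a < t ∧ (t : EReal) < b}
  is_open' := (isOpen_lt continuous_const continuous_id).inter
    (isOpen_lt continuous_coe_real_ereal continuous_const)

variable {a : ℝ} {b : EReal}

/-- Extension by `0` of a function on `[a, b)` to the real line. All notions below look only at
the values on `[a, b)`. -/
def ext (H : HalfOpen a b → ℝ) : ℝ → ℝ := Function.extend Subtype.val H 0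

/-- Local Henstock–Kurzweil integrability: integrability on every compact subinterval. -/
def LocHK (H : HalfOpen a b → ℝ) : Prop :=
  ∀ c d : ℝ, c < d → Set.Icc c d ⊆ HalfOpen a b → ∃ J : ℝ, HasHKIntegral (ext H) c d J

variable (a b) in
/-- Lebesgue measure on `[a, b)`. -/
abbrev lebesgue : Measure (HalfOpen a b) := (volume : Measure ℝ).comap Subtype.val

variable (a b) in
/-- `HK_loc([a,b))`: classes, modulo equality almost everywhere, of locally Henstock–Kurzweil
integrable functions on `[a, b)`. The order inherited from `Filter.Germ` is the almost everywhere
pointwise order. -/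
abbrev HKloc : Type :=
  {u : Germ (ae (lebesgue a b)) ℝ //
    ∃ H : HalfOpen a b → ℝ, LocHK H ∧ u = Germ.ofFun H}

/-- `H` belongs to `D^{lr}([a,b))`: left regulated, locally HK integrable, and with a right
limit at `a`. -/
def IsDlr (H : HalfOpen a b → ℝ) : Prop :=
  (∀ t : ℝ, a < t → (t : EReal) < b → ∃ L : ℝ, Tendsto (ext H) (𝓝[<] t) (𝓝 L)) ∧
  LocHK H ∧
  ∃ L : ℝ, Tendsto (ext H) (𝓝[>] a) (𝓝 L)

variable (a b) in
/-- `D^{lc}([a,b))`: the functions in `D^{lr}([a,b))` that are left continuous on `(a, b)` and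
right continuous at `a`. The order is the pointwise one. -/
abbrev Dlc : Type :=
  {y : HalfOpen a b → ℝ // IsDlr y ∧
    (∀ t : ℝ, a < t → (t : EReal) < b → Tendsto (ext y) (𝓝[<] t) (𝓝 (ext y t))) ∧
    Tendsto (ext y) (𝓝[>] a) (𝓝 (ext y a))}

/-- The value at the left endpoint. -/
def Dlc.initial (y : Dlc a b) : ℝ := ext y.1 a

/-- The canonical map from `D^{lc}([a,b))` to `HK_loc([a,b))`. -/
def Dlc.toHKloc (y : Dlc a b) : HKloc a b := ⟨Germ.ofFun y.1, y.1, y.2.1.2.1, rfl⟩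

/-! ### Distributions with primitives, and their order -/

/-- The distribution `T` on `(a, b)` is the distributional derivative of `H`, that is,
`⟨T, φ⟩ = -∫ H φ'` for every test function `φ`, the integral being taken in the sense of
Henstock–Kurzweil over any compact interval in `[a, b)` that contains the support of `φ`. -/
def IsDistribDeriv (T : 𝓓'(openInterval a b, ℝ)) (H : HalfOpen a b → ℝ) : Prop :=
  ∀ (φ : 𝓓(openInterval a b, ℝ)) (c d : ℝ), c < d → Set.Icc c d ⊆ HalfOpen a b →
    tsupport φ ⊆ Set.Icc c d → HasHKIntegral (fun t => ext H t * deriv φ t) c d (-(T φ))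

variable (a b) in
/-- `A_D([a,b))`: the distributions that have a primitive in `D^{lr}([a,b))`. -/
def AD : Type :=
  {T : 𝓓'(openInterval a b, ℝ) // ∃ H : HalfOpen a b → ℝ, IsDlr H ∧ IsDistribDeriv T H}

/-- `F` is the primitive of `f` in `D^{lc}_0([a,b))`, the space of those functions in
`D^{lc}([a,b))` whose right limit at `a` is `0`. -/
def IsNormalizedPrimitive (f : AD a b) (F : Dlc a b) : Prop :=
  IsDistribDeriv f.1 F.1 ∧ Tendsto (ext F.1) (𝓝[>] a) (𝓝 0)

/-- `f ⪯ g` in `A_D([a,b))`: the primitives `F` of `f` and `G` of `g` in `D^{lc}_0([a,b))`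
(which are unique) satisfy `F ≤ G`. -/
def AD.Preceq (f g : AD a b) : Prop :=
  ∃ F G : Dlc a b, IsNormalizedPrimitive f F ∧ IsNormalizedPrimitive g G ∧ F ≤ G

/-! ### The Cauchy system `y_i' = f_i(y_1, …, y_m)`, `y_i(a) = c_i` -/

variable {m : ℕ}

/-- Right-hand sides `f_i : HK_loc([a,b))^m → A_D([a,b))` that are all increasing. -/
def IsIncreasing (f : Fin m → (Fin m → HKloc a b) → AD a b) : Prop :=
  ∀ (i : Fin m) (u v : Fin m → HKloc a b), u ≤ v → (f i u).Preceq (f i v)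

/-- `y_i' ⪯ f_i(y)` in `A_D([a,b))` and `y_i(a) ≤ c_i` for every `i`. -/
def IsSubsolution (f : Fin m → (Fin m → HKloc a b) → AD a b) (c : Fin m → ℝ)
    (y : Fin m → Dlc a b) : Prop :=
  ∀ i : Fin m, (∃ g : AD a b, IsDistribDeriv g.1 (y i).1 ∧
    g.Preceq (f i fun j => (y j).toHKloc)) ∧ (y i).initial ≤ c i

/-- `f_i(y) ⪯ y_i'` in `A_D([a,b))` and `c_i ≤ y_i(a)` for every `i`. -/
def IsSupersolution (f : Fin m → (Fin m → HKloc a b) → AD a b) (c : Fin m → ℝ)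
    (y : Fin m → Dlc a b) : Prop :=
  ∀ i : Fin m, (∃ g : AD a b, IsDistribDeriv g.1 (y i).1 ∧
    (f i fun j => (y j).toHKloc).Preceq g) ∧ c i ≤ (y i).initial

/-- `y_i' = f_i(y)` and `y_i(a) = c_i` for every `i`. -/
def IsSolution (f : Fin m → (Fin m → HKloc a b) → AD a b) (c : Fin m → ℝ)
    (y : Fin m → Dlc a b) : Prop :=
  ∀ i : Fin m, IsDistribDeriv (f i fun j => (y j).toHKloc).1 (y i).1 ∧ (y i).initial = c i

/-- The solutions of the system in the order interval `[ylo, yhi]` of `D^{lc}([a,b))^m`. -/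
def solutionsIn (f : Fin m → (Fin m → HKloc a b) → AD a b) (c : Fin m → ℝ)
    (ylo yhi : Fin m → Dlc a b) : Set (Fin m → Dlc a b) :=
  {y | y ∈ Set.Icc ylo yhi ∧ IsSolution f c y}

end

end DistribCauchy

/-!
For `u` in `HK_loc([a,b))^m` let `Φ u = c + F(f u)`, where `F` is the normalized primitive. Two
functions in `D^{lc}([a,b))` with the same distributional derivative differ by a constant
(`Dlc.sub_eq_of_isDistribDeriv`), so normalized primitives are unique, `Φ` is increasing, the
solutions of the system are the fixed points of `Φ`, a subsolution `y` satisfies `y ≤ Φ y`, and a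
supersolution satisfies `Φ y ≤ y`. Uniqueness is seen by testing with smooth functions that rise
from `0` to `1` just before `x` and fall back to `0` just before `y`: left continuity turns the
vanishing of the integral into equality of the values at `x` and at `y`.

The order interval `[ylo, yhi]` of `D^{lc}([a,b))^m` is not a complete lattice: a pointwise supremum
of left continuous functions with left limits need not have left limits. However, `Φ` is defined on
the larger space `HK_loc([a,b))^m` and maps it into `D^{lc}([a,b))^m`. In `HK_loc([a,b))` the
measurable classes between `ylo i` and `yhi i` do form a complete lattice
(`completeLatticeMeasInterval`): subtracting `ylo i` turns them into nonnegative functions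
dominated by `yhi i - ylo i`, which is locally Lebesgue integrable because it is nonnegative,
measurable and Henstock–Kurzweil integrable (`HasHKIntegral.integrableOn`), and for nonnegative
functions essential infima exist (`exists_measurable_ae_isGLB`). Since `Φ` maps the product of these
lattices into itself, the Knaster–Tarski theorem provides extremal fixed points `u` there, and `Φ u`
is an extremal solution in `D^{lc}([a,b))^m`.

The least fixed point lies below every point `z` with `Φ z ≤ z`, hence below all supersolutions in
the interval; dually for the greatest one (`exists_extremal_solutions`). Monotone dependence on the
data follows, as a solution for larger data is a supersolution for the smaller data.
-/

open MeasureTheory Filter Topology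
open scoped Distributions

namespace DistribCauchy

variable {a : ℝ} {b : EReal} {m : ℕ}

/-! ### The Henstock–Kurzweil and the Lebesgue integral on a compact interval -/

theorem HasHKIntegral.add {f g : ℝ → ℝ} {c d I J : ℝ} (hf : HasHKIntegral f c d I)
    (hg : HasHKIntegral g c d J) : HasHKIntegral (fun t => f t + g t) c d (I + J) := by
  obtain ⟨h, hf⟩ := hf
  obtain ⟨_, hg⟩ := hg
  exact ⟨h, hf.add hg⟩

theorem HasHKIntegral.sub {f g : ℝ → ℝ} {c d I J : ℝ} (hf : HasHKIntegral f c d I)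
    (hg : HasHKIntegral g c d J) : HasHKIntegral (fun t => f t - g t) c d (I - J) := by
  obtain ⟨h, hf⟩ := hf
  obtain ⟨_, hg⟩ := hg
  exact ⟨h, hf.sub hg⟩

theorem HasHKIntegral.le {f g : ℝ → ℝ} {c d I J : ℝ} (hf : HasHKIntegral f c d I)
    (hg : HasHKIntegral g c d J) (hfg : ∀ t ∈ Set.Icc c d, f t ≤ g t) : I ≤ J := by
  obtain ⟨h, hfg'⟩ := hg.sub hf
  rw [← sub_nonneg, ← hfg'.integral_eq]
  refine BoxIntegral.integral_nonneg (fun x hx => sub_nonneg.2 (hfg _ ?_)) _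
  exact ⟨hx.1 0, hx.2 0⟩

/-- A Lebesgue integrable function is Henstock–Kurzweil integrable, with the same integral. -/
theorem hasHKIntegral_of_integrableOn {g : ℝ → ℝ} {c d : ℝ} (h : c < d)
    (hg : IntegrableOn g (Set.Ioc c d)) : HasHKIntegral g c d (∫ t in c..d, g t) := by
  have hbox : (hkBox c d h : Set (Fin 1 → ℝ)) =
      MeasurableEquiv.funUnique (Fin 1) ℝ ⁻¹' Set.Ioc c d := by
    ext x
    simp only [BoxIntegral.Box.mem_coe, BoxIntegral.Box.mem_def, Fin.forall_fin_one]
    rfl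
  have hmp := volume_preserving_funUnique (Fin 1) ℝ
  have hemb := (MeasurableEquiv.funUnique (Fin 1) ℝ).measurableEmbedding
  have hint : IntegrableOn (g ∘ MeasurableEquiv.funUnique (Fin 1) ℝ)
      (hkBox c d h : Set (Fin 1 → ℝ)) := by
    rw [hbox]
    exact (hmp.integrableOn_comp_preimage hemb).2 hg
  have := hint.hasBoxIntegral BoxIntegral.IntegrationParams.Henstock rfl
  refine ⟨h, ?_⟩
  convert! this using 1
  rw [intervalIntegral.integral_of_le h.le, hbox]
  exact (hmp.setIntegral_preimage_emb hemb _ _).symm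

theorem hasHKIntegral_of_continuous {g : ℝ → ℝ} {c d : ℝ} (h : c < d) (hg : Continuous g) :
    HasHKIntegral g c d (∫ t in c..d, g t) :=
  hasHKIntegral_of_integrableOn h (hg.integrableOn_Icc.mono_set Set.Ioc_subset_Icc_self)

theorem HasHKIntegral.congr {f g : ℝ → ℝ} {c d J : ℝ} (hf : HasHKIntegral f c d J)
    (hfg : ∀ t ∈ Set.Icc c d, f t = g t) : HasHKIntegral g c d J := by
  have hz : Set.EqOn (fun t => g t - f t) (fun _ => 0) (Set.Ioc c d) := fun t ht =>
    sub_eq_zero.2 (hfg t (Set.Ioc_subset_Icc_self ht)).symm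
  have h0 := hasHKIntegral_of_integrableOn hf.1
    ((integrableOn_zero (ε' := ℝ)).congr_fun hz.symm measurableSet_Ioc)
  have hI : ∫ t in c..d, (g t - f t) = 0 := by
    rw [intervalIntegral.integral_of_le hf.1.le, setIntegral_congr_fun measurableSet_Ioc hz]
    simp
  rw [hI] at h0
  simpa using hf.add h0

/-- A nonnegative measurable function that is Henstock–Kurzweil integrable is Lebesgue integrable:
its truncations are bounded, and their integrals do not exceed the Henstock–Kurzweil integral. -/
theorem HasHKIntegral.integrableOn {g : ℝ → ℝ} {c d J : ℝ} (hg : HasHKIntegral g c d J)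
    (hm : AEMeasurable g (volume.restrict (Set.Ioc c d))) (h0 : ∀ t ∈ Set.Icc c d, 0 ≤ g t) :
    IntegrableOn g (Set.Ioc c d) := by
  have hae : ∀ᵐ t ∂volume.restrict (Set.Ioc c d), 0 ≤ g t :=
    (ae_restrict_iff' measurableSet_Ioc).2 (ae_of_all _ fun t ht =>
      h0 t (Set.Ioc_subset_Icc_self ht))
  have htrunc (n : ℕ) : ∫⁻ t in Set.Ioc c d, ENNReal.ofReal (min (g t) n) ≤ ENNReal.ofReal J := by
    have hmn : AEMeasurable (fun t => min (g t) n) (volume.restrict (Set.Ioc c d)) :=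
      hm.min aemeasurable_const
    have hpos : ∀ᵐ t ∂volume.restrict (Set.Ioc c d), 0 ≤ min (g t) n :=
      hae.mono fun t ht => le_min ht n.cast_nonneg
    have hint : IntegrableOn (fun t => min (g t) n) (Set.Ioc c d) := by
      refine IntegrableOn.of_bound (by simp) hmn.aestronglyMeasurable n ?_
      filter_upwards [hpos] with t ht
      rw [Real.norm_of_nonneg ht]
      exact min_le_right _ _
    rw [← ofReal_integral_eq_lintegral_ofReal hint hpos,
      ← intervalIntegral.integral_of_le hg.1.le]
    exact ENNReal.ofReal_le_ofReal
      ((hasHKIntegral_of_integrableOn hg.1 hint).le hg fun t _ => min_le_left _ _)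
  have hsup (x : ℝ) : ⨆ n : ℕ, ENNReal.ofReal (min x n) = ENNReal.ofReal x := by
    refine le_antisymm (iSup_le fun n => ENNReal.ofReal_le_ofReal (min_le_left _ _)) ?_
    obtain ⟨n, hn⟩ := exists_nat_ge x
    refine le_iSup_of_le n ?_
    rw [min_eq_left hn]
  refine ⟨hm.aestronglyMeasurable, ?_⟩
  rw [hasFiniteIntegral_iff_ofReal hae]
  calc ∫⁻ t in Set.Ioc c d, ENNReal.ofReal (g t)
      = ∫⁻ t in Set.Ioc c d, ⨆ n : ℕ, ENNReal.ofReal (min (g t) n) := by simp only [hsup]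
    _ = ⨆ n : ℕ, ∫⁻ t in Set.Ioc c d, ENNReal.ofReal (min (g t) n) := by
        refine lintegral_iSup' (fun n => (hm.min aemeasurable_const).ennreal_ofReal)
          (ae_of_all _ fun t n k hnk => ENNReal.ofReal_le_ofReal ?_)
        exact min_le_min_left _ (Nat.cast_le.2 hnk)
    _ ≤ ENNReal.ofReal J := iSup_le htrunc
    _ < ⊤ := ENNReal.ofReal_lt_top

/-! ### Extension by zero -/

theorem ext_apply (H : HalfOpen a b → ℝ) {t : ℝ} (ht : t ∈ HalfOpen a b) : ext H t = H ⟨t, ht⟩ :=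
  Subtype.val_injective.extend_apply H 0 ⟨t, ht⟩

theorem Icc_subset_halfOpen {c d : ℝ} (hc : a ≤ c) (hd : (d : EReal) < b) :
    Set.Icc c d ⊆ HalfOpen a b := fun _ ht =>
  ⟨hc.trans ht.1, (EReal.coe_le_coe_iff.2 ht.2).trans_lt hd⟩

theorem eventually_mem_halfOpen_left {t : ℝ} (ht : a < t) (htb : (t : EReal) < b) :
    ∀ᶠ s in 𝓝[<] t, s ∈ HalfOpen a b := by
  filter_upwards [Ioo_mem_nhdsLT ht] with s hs
  exact ⟨hs.1.le, (EReal.coe_lt_coe_iff.2 hs.2).trans htb⟩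

theorem eventually_mem_halfOpen_right (hab : (a : EReal) < b) :
    ∀ᶠ s in 𝓝[>] a, s ∈ HalfOpen a b := by
  have : ∀ᶠ s : ℝ in 𝓝 a, (s : EReal) < b :=
    continuous_coe_real_ereal.continuousAt.eventually (gt_mem_nhds hab)
  filter_upwards [self_mem_nhdsWithin, nhdsWithin_le_nhds this] with s hs hsb
  exact ⟨le_of_lt hs, hsb⟩

/-! ### Smooth steps -/

/-- A smooth nondecreasing function that is `0` on `(-∞, x - ε]` and `1` on `[x, ∞)`. Its
derivative is an approximate unit mass located immediately to the left of `x`. -/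
noncomputable def smoothStep (ε x t : ℝ) : ℝ := Real.smoothTransition ((t - x) / ε + 1)

theorem contDiff_smoothStep (ε x : ℝ) : ContDiff ℝ (⊤ : ℕ∞) (smoothStep ε x) :=
  Real.smoothTransition.contDiff.comp (by fun_prop)

theorem differentiable_smoothStep (ε x : ℝ) : Differentiable ℝ (smoothStep ε x) :=
  (contDiff_smoothStep ε x).differentiable (by simp)

theorem continuous_deriv_smoothStep (ε x : ℝ) : Continuous (deriv (smoothStep ε x)) :=
  (contDiff_smoothStep ε x).continuous_deriv (by simp)

theorem smoothStep_eq_zero {ε x t : ℝ} (hε : 0 < ε) (ht : t ≤ x - ε) : smoothStep ε x t = 0 := by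
  apply Real.smoothTransition.zero_of_nonpos
  have : (t - x) / ε ≤ -1 := by rw [div_le_iff₀ hε]; linarith
  linarith

theorem smoothStep_eq_one {ε x t : ℝ} (hε : 0 < ε) (ht : x ≤ t) : smoothStep ε x t = 1 := by
  apply Real.smoothTransition.one_of_one_le
  have : 0 ≤ (t - x) / ε := div_nonneg (by linarith) hε.le
  linarith

theorem monotone_smoothStep {ε : ℝ} (hε : 0 < ε) (x : ℝ) : Monotone (smoothStep ε x) := by
  intro s t hst
  apply Real.smoothTransition.monotone
  gcongr

theorem deriv_smoothStep_nonneg {ε : ℝ} (hε : 0 < ε) (x t : ℝ) : 0 ≤ deriv (smoothStep ε x) t :=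
  (monotone_smoothStep hε x).deriv_nonneg

theorem deriv_smoothStep_eq_zero {ε x t : ℝ} (hε : 0 < ε) (ht : t ∉ Set.Icc (x - ε) x) :
    deriv (smoothStep ε x) t = 0 := by
  rw [Set.mem_Icc, not_and_or, not_le, not_le] at ht
  rcases ht with ht | ht
  · have : smoothStep ε x =ᶠ[𝓝 t] fun _ => 0 := by
      filter_upwards [gt_mem_nhds ht] with s hs using smoothStep_eq_zero hε (le_of_lt hs)
    rw [this.deriv_eq, deriv_const]
  · have : smoothStep ε x =ᶠ[𝓝 t] fun _ => 1 := by
      filter_upwards [lt_mem_nhds ht] with s hs using smoothStep_eq_one hε (le_of_lt hs)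
    rw [this.deriv_eq, deriv_const]

theorem integral_deriv_smoothStep {ε x c d : ℝ} (hε : 0 < ε) (hc : c ≤ x - ε) (hd : x ≤ d) :
    ∫ t in c..d, deriv (smoothStep ε x) t = 1 := by
  rw [intervalIntegral.integral_deriv_eq_sub (fun t _ => differentiable_smoothStep ε x t)
    ((continuous_deriv_smoothStep ε x).intervalIntegrable _ _), smoothStep_eq_one hε hd,
    smoothStep_eq_zero hε hc, sub_zero]

theorem tsupport_smoothStep_sub_subset {ε x y : ℝ} (hε : 0 < ε) (hxy : x < y) :
    tsupport (fun t => smoothStep ε x t - smoothStep ε y t) ⊆ Set.Icc (x - ε) y := by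
  refine closure_minimal (fun t ht => ?_) isClosed_Icc
  by_contra h
  apply ht
  rw [Set.mem_Icc, not_and_or, not_le, not_le] at h
  rcases h with h | h
  · simp [smoothStep_eq_zero hε h.le, smoothStep_eq_zero hε (by linarith : t ≤ y - ε)]
  · simp [smoothStep_eq_one hε h.le, smoothStep_eq_one hε (hxy.trans h).le]

/-- The test function on `(a, b)` that rises from `0` to `1` just before `x` and falls back to `0`
just before `y`. -/
noncomputable def bumpBetween {ε x y : ℝ} (hε : 0 < ε) (hxy : x < y) (hx : a < x - ε)
    (hy : (y : EReal) < b) : 𝓓(openInterval a b, ℝ) where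
  toFun := fun t => smoothStep ε x t - smoothStep ε y t
  contDiff' := (contDiff_smoothStep ε x).sub (contDiff_smoothStep ε y)
  hasCompactSupport' := isCompact_Icc.of_isClosed_subset (isClosed_tsupport _)
    (tsupport_smoothStep_sub_subset hε hxy)
  tsupport_subset' := fun _ ht =>
    have h := tsupport_smoothStep_sub_subset hε hxy ht
    ⟨hx.trans_le h.1, (EReal.coe_le_coe_iff.2 h.2).trans_lt hy⟩

theorem coe_bumpBetween {ε x y : ℝ} (hε : 0 < ε) (hxy : x < y) (hx : a < x - ε)
    (hy : (y : EReal) < b) : ⇑(bumpBetween hε hxy hx hy) =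
      fun t => smoothStep ε x t - smoothStep ε y t := rfl

theorem deriv_bumpBetween {ε x y : ℝ} (hε : 0 < ε) (hxy : x < y) (hx : a < x - ε)
    (hy : (y : EReal) < b) (t : ℝ) : deriv (bumpBetween hε hxy hx hy) t =
      deriv (smoothStep ε x) t - deriv (smoothStep ε y) t := by
  rw [coe_bumpBetween]
  exact deriv_fun_sub (differentiable_smoothStep ε x t) (differentiable_smoothStep ε y t)

/-! ### Uniqueness of left continuous primitives up to a constant -/

/-- If `K` is left continuous at `x`, multiplying by the derivative of a sufficiently steep step at
`x` nearly replaces `K` by the constant `K x`. -/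
theorem eventually_mul_deriv_smoothStep_le {K : ℝ → ℝ} {x η : ℝ} (hη : 0 < η)
    (hK : Tendsto K (𝓝[<] x) (𝓝 (K x))) :
    ∀ᶠ ε in 𝓝[>] (0 : ℝ), ∀ t,
      K t * deriv (smoothStep ε x) t ≤ (K x + η) * deriv (smoothStep ε x) t := by
  obtain ⟨l, hl, hlx⟩ := (mem_nhdsLT_iff_exists_Ioo_subset).1
    (hK.eventually (gt_mem_nhds (lt_add_of_pos_right (K x) hη)))
  filter_upwards [Ioo_mem_nhdsGT (sub_pos.2 hl)] with ε hε t
  by_cases ht : t ∈ Set.Icc (x - ε) x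
  · refine mul_le_mul_of_nonneg_right ?_ (deriv_smoothStep_nonneg hε.1 x t)
    rcases ht.2.eq_or_lt with rfl | htx
    · linarith
    · exact le_of_lt (hlx ⟨by linarith [ht.1, hε.2], htx⟩)
  · simp [deriv_smoothStep_eq_zero hε.1 ht]

/-- One half of the uniqueness of primitives. It suffices to test with `bumpBetween`, whose derivative
is the difference of two approximate unit masses just before `x` and just before `y`. -/
theorem sub_le_sub_of_isDistribDeriv {T : 𝓓'(openInterval a b, ℝ)} {H₁ H₂ : HalfOpen a b → ℝ}
    (h₁ : IsDistribDeriv T H₁) (h₂ : IsDistribDeriv T H₂) {x y : ℝ} (hx : a < x) (hxy : x < y)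
    (hy : (y : EReal) < b)
    (h₁x : Tendsto (ext H₁) (𝓝[<] x) (𝓝 (ext H₁ x)))
    (h₁y : Tendsto (ext H₁) (𝓝[<] y) (𝓝 (ext H₁ y)))
    (h₂x : Tendsto (ext H₂) (𝓝[<] x) (𝓝 (ext H₂ x)))
    (h₂y : Tendsto (ext H₂) (𝓝[<] y) (𝓝 (ext H₂ y))) :
    ext H₁ y - ext H₂ y ≤ ext H₁ x - ext H₂ x := by
  refine le_of_forall_pos_le_add fun η hη => ?_
  obtain ⟨ε, ⟨hεx, hεy⟩, hε, hεa⟩ := ((eventually_mul_deriv_smoothStep_le (half_pos hη)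
    (K := fun t => ext H₁ t - ext H₂ t) (h₁x.sub h₂x)).and
    (eventually_mul_deriv_smoothStep_le (half_pos hη)
    (K := fun t => ext H₂ t - ext H₁ t) (h₂y.sub h₁y)) |>.and
      (Ioo_mem_nhdsGT (sub_pos.2 hx))).exists
  have hxa : a < x - ε := by linarith
  have hlt : x - ε < y := by linarith
  have hsub := Icc_subset_halfOpen hxa.le hy
  have hts : tsupport (bumpBetween hε hxy hxa hy) ⊆ Set.Icc (x - ε) y :=
    tsupport_smoothStep_sub_subset hε hxy
  have h0 := (h₁ _ _ _ hlt hsub hts).sub (h₂ _ _ _ hlt hsub hts)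
  rw [sub_self] at h0
  have hcx := continuous_deriv_smoothStep ε x
  have hcy := continuous_deriv_smoothStep ε y
  have hmaj := hasHKIntegral_of_continuous hlt
    (g := fun t => (ext H₁ x - ext H₂ x + η / 2) * deriv (smoothStep ε x) t +
      (ext H₂ y - ext H₁ y + η / 2) * deriv (smoothStep ε y) t) (by fun_prop)
  rw [intervalIntegral.integral_add ((hcx.const_mul _).intervalIntegrable _ _)
    ((hcy.const_mul _).intervalIntegrable _ _), intervalIntegral.integral_const_mul,
    intervalIntegral.integral_const_mul, integral_deriv_smoothStep hε le_rfl hxy.le,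
    integral_deriv_smoothStep hε (by linarith) le_rfl] at hmaj
  have := h0.le hmaj fun t _ => by
    rw [deriv_bumpBetween]
    linarith [hεx t, hεy t]
  linarith

/-- Two functions in `D^{lc}([a,b))` with the same distributional derivative differ by a
constant. -/
theorem Dlc.sub_eq_of_isDistribDeriv {T : 𝓓'(openInterval a b, ℝ)}
    {Y Z : Dlc a b} (hY : IsDistribDeriv T Y.1) (hZ : IsDistribDeriv T Z.1) {t : ℝ}
    (ht : t ∈ HalfOpen a b) : ext Y.1 t - ext Z.1 t = Y.initial - Z.initial := by
  rcases ht.1.eq_or_lt with rfl | hat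
  · rfl
  have hconst : ∀ s ∈ Set.Ioo a t, ext Y.1 s - ext Z.1 s = ext Y.1 t - ext Z.1 t := by
    intro s hs
    have hsb : (s : EReal) < b := (EReal.coe_lt_coe_iff.2 hs.2).trans ht.2
    have h1 := sub_le_sub_of_isDistribDeriv hY hZ hs.1 hs.2 ht.2 (Y.2.2.1 s hs.1 hsb)
      (Y.2.2.1 t hat ht.2) (Z.2.2.1 s hs.1 hsb) (Z.2.2.1 t hat ht.2)
    have h2 := sub_le_sub_of_isDistribDeriv hZ hY hs.1 hs.2 ht.2 (Z.2.2.1 s hs.1 hsb)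
      (Z.2.2.1 t hat ht.2) (Y.2.2.1 s hs.1 hsb) (Y.2.2.1 t hat ht.2)
    linarith
  have hlim : Tendsto (fun s => ext Y.1 s - ext Z.1 s) (𝓝[>] a) (𝓝 (Y.initial - Z.initial)) :=
    Y.2.2.2.sub Z.2.2.2
  refine tendsto_nhds_unique_of_eventuallyEq tendsto_const_nhds hlim ?_
  filter_upwards [Ioo_mem_nhdsGT hat] with s hs using (hconst s hs).symm

theorem IsNormalizedPrimitive.initial_eq_zero {f : AD a b} {F : Dlc a b}
    (hF : IsNormalizedPrimitive f F) : F.initial = 0 :=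
  tendsto_nhds_unique F.2.2.2 hF.2

/-! ### Adding constants -/

/-- The function `Y + k`. -/
def Dlc.addConst (hab : (a : EReal) < b) (Y : Dlc a b) (k : ℝ) : Dlc a b :=
  have hext : ∀ t ∈ HalfOpen a b, ext Y.1 t + k = ext (fun s => Y.1 s + k) t := fun t ht => by
    rw [ext_apply _ ht, ext_apply _ ht]
  have hr : Tendsto (ext fun s => Y.1 s + k) (𝓝[>] a) (𝓝 (ext (fun s => Y.1 s + k) a)) := by
    rw [← hext a ⟨le_rfl, hab⟩]
    exact (Y.2.2.2.add_const k).congr' ((eventually_mem_halfOpen_right hab).mono hext)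
  have hl : ∀ t : ℝ, a < t → (t : EReal) < b →
      Tendsto (ext fun s => Y.1 s + k) (𝓝[<] t) (𝓝 (ext (fun s => Y.1 s + k) t)) := by
    intro t hat htb
    rw [← hext t ⟨hat.le, htb⟩]
    exact ((Y.2.2.1 t hat htb).add_const k).congr'
      ((eventually_mem_halfOpen_left hat htb).mono hext)
  ⟨fun s => Y.1 s + k, ⟨fun t hat htb => ⟨_, hl t hat htb⟩, fun c d hcd hsub => by
    obtain ⟨J, hJ⟩ := Y.2.1.2.1 c d hcd hsub
    exact ⟨_, (hJ.add (hasHKIntegral_of_continuous hcd (continuous_const (y := k)))).congr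
      fun t ht => hext t (hsub ht)⟩, _, hr⟩, hl, hr⟩

theorem Dlc.addConst_apply (hab : (a : EReal) < b) (Y : Dlc a b) (k : ℝ) (s : HalfOpen a b) :
    (Y.addConst hab k).1 s = Y.1 s + k := rfl

theorem Dlc.initial_eq (hab : (a : EReal) < b) (Y : Dlc a b) :
    Y.initial = Y.1 ⟨a, le_rfl, hab⟩ := ext_apply _ _

theorem Dlc.initial_addConst (hab : (a : EReal) < b) (Y : Dlc a b) (k : ℝ) :
    (Y.addConst hab k).initial = Y.initial + k := by
  rw [initial_eq hab, initial_eq hab, addConst_apply]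

/-- Constants do not change the distributional derivative, since the derivative of a test function
has integral `0`. -/
theorem IsDistribDeriv.addConst (hab : (a : EReal) < b) {T : 𝓓'(openInterval a b, ℝ)}
    {Y : Dlc a b} (hY : IsDistribDeriv T Y.1) (k : ℝ) :
    IsDistribDeriv T (Y.addConst hab k).1 := by
  intro φ c d hcd hsub hsupp
  have hd : Differentiable ℝ φ := φ.contDiff.differentiable (by simp)
  have hc : Continuous (deriv φ) := φ.contDiff.continuous_deriv (by simp)
  -- the endpoints may lie in `Set.Icc c d`, but not in the open set where `φ` is nonzero
  have hsupp' : Function.support φ ⊆ Set.Ioo c d := by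
    rw [← interior_Icc]
    exact interior_maximal ((subset_tsupport φ).trans hsupp)
      (isOpen_ne.preimage φ.continuous)
  have hφc : φ c = 0 := by
    by_contra h
    exact lt_irrefl c (hsupp' h).1
  have hφd : φ d = 0 := by
    by_contra h
    exact lt_irrefl d (hsupp' h).2
  have hk := hasHKIntegral_of_continuous hcd (hc.const_mul k)
  rw [intervalIntegral.integral_const_mul, intervalIntegral.integral_deriv_eq_sub
    (fun t _ => hd t) (hc.intervalIntegrable _ _), hφc, hφd, sub_zero, mul_zero] at hk
  have := (hY φ c d hcd hsub hsupp).add hk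
  rw [add_zero] at this
  refine this.congr fun t ht => ?_
  rw [ext_apply _ (hsub ht), ext_apply _ (hsub ht), Dlc.addConst_apply, add_mul]

/-- A primitive with prescribed initial value is the normalized primitive plus a constant. -/
theorem IsNormalizedPrimitive.eq_addConst (hab : (a : EReal) < b) {f : AD a b} {F Y : Dlc a b}
    (hF : IsNormalizedPrimitive f F) (hY : IsDistribDeriv f.1 Y.1) :
    Y = F.addConst hab Y.initial := by
  refine Subtype.ext (funext fun s => ?_)
  have := Dlc.sub_eq_of_isDistribDeriv hY hF.1 s.2
  rw [hF.initial_eq_zero, ext_apply _ s.2, ext_apply _ s.2] at this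
  rw [Dlc.addConst_apply]
  linarith

theorem IsNormalizedPrimitive.unique (hab : (a : EReal) < b) {f : AD a b} {F G : Dlc a b}
    (hF : IsNormalizedPrimitive f F) (hG : IsNormalizedPrimitive f G) : F = G := by
  rw [hG.eq_addConst hab hF.1, hF.initial_eq_zero]
  exact Subtype.ext (funext fun s => add_zero _)

theorem AD.Preceq.le (hab : (a : EReal) < b) {f g : AD a b} (h : f.Preceq g) {F G : Dlc a b}
    (hF : IsNormalizedPrimitive f F) (hG : IsNormalizedPrimitive g G) : F ≤ G := by
  obtain ⟨F', G', hF', hG', hle⟩ := h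
  rwa [hF.unique hab hF', hG.unique hab hG']

/-! ### Essential infima of families of measurable functions -/

/-- Every family of functions with values in `[0, ∞]`, one of which is finite almost
everywhere, has a greatest measurable lower bound for the almost everywhere order. It is the density of the
infimum, in the complete lattice of measures, of the measures with these densities. -/
theorem exists_measurable_ae_isGLB {α : Type*} [MeasurableSpace α] (μ : Measure α) [SigmaFinite μ]
    (S : Set (α → ENNReal)) {w₀ : α → ENNReal} (hw₀ : w₀ ∈ S)
    (hfin : ∀ᵐ x ∂μ, w₀ x ≠ ⊤) :
    ∃ d : α → ENNReal, Measurable d ∧ (∀ w ∈ S, d ≤ᵐ[μ] w) ∧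
      ∀ v : α → ENNReal, Measurable v → (∀ w ∈ S, v ≤ᵐ[μ] w) → v ≤ᵐ[μ] d := by
  have hle : ∀ u v : α → ENNReal, Measurable u → μ.withDensity u ≤ μ.withDensity v →
      u ≤ᵐ[μ] v := fun u v hu h =>
    ae_le_of_forall_setLIntegral_le_of_sigmaFinite hu fun s hs _ => by
      rw [← withDensity_apply _ hs, ← withDensity_apply _ hs]
      exact h s
  set ν : Measure α := sInf (μ.withDensity '' S) with hν
  have hνle : ∀ w ∈ S, ν ≤ μ.withDensity w := fun w hw => sInf_le (Set.mem_image_of_mem _ hw)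
  have : SigmaFinite (μ.withDensity w₀) := SigmaFinite.withDensity_of_ne_top hfin
  have : SigmaFinite ν := Measure.sigmaFinite_of_le _ (hνle w₀ hw₀)
  have hac : ν ≪ μ :=
    (Measure.absolutelyContinuous_of_le (hνle w₀ hw₀)).trans (withDensity_absolutelyContinuous _ _)
  have hd : μ.withDensity (ν.rnDeriv μ) = ν := Measure.withDensity_rnDeriv_eq _ _ hac
  refine ⟨ν.rnDeriv μ, Measure.measurable_rnDeriv _ _, fun w hw => ?_, fun v hv hvS => ?_⟩
  · exact hle _ _ (Measure.measurable_rnDeriv _ _) (hd.symm ▸ hνle w hw)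
  · refine hle _ _ hv ?_
    rw [hd]
    refine le_sInf ?_
    rintro _ ⟨w, hw, rfl⟩
    exact withDensity_mono (hvS w hw)

/-! ### Measurability of left continuous functions -/

theorem measurableSet_halfOpen : MeasurableSet (HalfOpen a b) :=
  measurableSet_Ici.inter (measurableSet_lt measurable_coe_real_ereal measurable_const)

instance : SigmaFinite (lebesgue a b) := by
  refine SigmaFinite.of_map _ (measurable_subtype_coe (p := (· ∈ HalfOpen a b))).aemeasurable ?_
  rw [map_comap_subtype_coe measurableSet_halfOpen]
  infer_instance

theorem ae_lebesgue_left_lt : ∀ᵐ s : HalfOpen a b ∂lebesgue a b, a < (s : ℝ) := by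
  refine (ae_restrict_iff_subtype (p := fun t => a < t) measurableSet_halfOpen).1 ?_
  have hne : ∀ᵐ t : ℝ ∂volume.restrict (HalfOpen a b), t ≠ a :=
    ae_restrict_of_ae (by simp [ae_iff])
  filter_upwards [hne, ae_restrict_mem measurableSet_halfOpen] with t hta ht
  exact lt_of_le_of_ne ht.1 (Ne.symm hta)

theorem tendsto_ceil_mul_sub_one_div (t : ℝ) :
    Tendsto (fun n : ℕ => ((⌈((n : ℝ) + 1) * t⌉ : ℝ) - 1) / ((n : ℝ) + 1)) atTop (𝓝[<] t) := by
  refine tendsto_nhdsWithin_iff.2 ⟨?_, Eventually.of_forall fun n => ?_⟩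
  · have hlow : Tendsto (fun n : ℕ => t - 1 / ((n : ℝ) + 1)) atTop (𝓝 t) := by
      simpa using tendsto_const_nhds.sub (tendsto_one_div_add_atTop_nhds_zero_nat (𝕜 := ℝ))
    refine tendsto_of_tendsto_of_tendsto_of_le_of_le hlow tendsto_const_nhds
      (fun n => ?_) (fun n => ?_)
    · have hn : (0 : ℝ) < n + 1 := by positivity
      have := Int.le_ceil (((n : ℝ) + 1) * t)
      show t - 1 / ((n : ℝ) + 1) ≤ _
      rw [le_div_iff₀ hn, sub_mul, div_mul_cancel₀ _ hn.ne']
      linarith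
    · have hn : (0 : ℝ) < n + 1 := by positivity
      have := Int.ceil_lt_add_one (((n : ℝ) + 1) * t)
      show _ / ((n : ℝ) + 1) ≤ t
      rw [div_le_iff₀ hn]
      linarith
  · have hn : (0 : ℝ) < n + 1 := by positivity
    have := Int.ceil_lt_add_one (((n : ℝ) + 1) * t)
    show _ / ((n : ℝ) + 1) < t
    rw [div_lt_iff₀ hn]
    linarith

/-- Away from `a`, a left continuous function is the limit of its values at the points
`(⌈n t⌉ - 1) / n`, which depend on `t` only through an integer. -/
theorem Dlc.aemeasurable (Y : Dlc a b) : AEMeasurable Y.1 (lebesgue a b) := by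
  refine aemeasurable_of_tendsto_metrizable_ae atTop
    (f := fun (n : ℕ) (s : HalfOpen a b) =>
      ext Y.1 (((⌈((n : ℝ) + 1) * (s : ℝ)⌉ : ℝ) - 1) / ((n : ℝ) + 1))) (fun n => ?_) ?_
  · have hg : Measurable fun k : ℤ => ext Y.1 (((k : ℝ) - 1) / ((n : ℝ) + 1)) :=
      measurable_from_top
    exact (hg.comp (Int.measurable_ceil.comp
      (measurable_subtype_coe.const_mul ((n : ℝ) + 1)))).aemeasurable
  · filter_upwards [ae_lebesgue_left_lt] with s hs
    rw [← ext_apply Y.1 s.2]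
    exact (Y.2.2.1 s hs s.2.2).comp (tendsto_ceil_mul_sub_one_div s)

/-! ### The complete lattice of measurable classes in an order interval -/

/-- The class `u` has a measurable representative. -/
def HKloc.IsMeasurable (u : HKloc a b) : Prop :=
  ∃ H : HalfOpen a b → ℝ, Measurable H ∧ u.1 = Germ.ofFun H

theorem Dlc.isMeasurable_toHKloc (Y : Dlc a b) : Y.toHKloc.IsMeasurable :=
  ⟨Y.aemeasurable.mk Y.1, Y.aemeasurable.measurable_mk, Germ.coe_eq.2 Y.aemeasurable.ae_eq_mk⟩

theorem Dlc.toHKloc_mono {Y Z : Dlc a b} (h : Y ≤ Z) : Y.toHKloc ≤ Z.toHKloc :=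
  Germ.coe_le.2 (Eventually.of_forall h)

/-- The measurable classes of locally Henstock–Kurzweil integrable functions between `lo` and
`hi`. Elements of `D^{lc}([a,b))` are measurable, so nothing is lost by this restriction, and it
saves the proof that all Henstock–Kurzweil integrable functions are measurable. -/
abbrev MeasInterval (lo hi : Dlc a b) : Type :=
  {u : HKloc a b // u.IsMeasurable ∧ u ∈ Set.Icc lo.toHKloc hi.toHKloc}

theorem aemeasurable_ext {H : HalfOpen a b → ℝ} (hH : AEMeasurable H (lebesgue a b)) :
    AEMeasurable (ext H) (volume.restrict (HalfOpen a b)) := by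
  have hemb := MeasurableEmbedding.subtype_coe (measurableSet_halfOpen (a := a) (b := b))
  rw [← map_comap_subtype_coe measurableSet_halfOpen, hemb.aemeasurable_map_iff]
  exact hH.congr (Eventually.of_forall fun s => (ext_apply H s.2).symm)

theorem ae_restrict_ext_le {G H : HalfOpen a b → ℝ} (h : G ≤ᵐ[lebesgue a b] H) :
    ext G ≤ᵐ[volume.restrict (HalfOpen a b)] ext H := by
  refine (ae_restrict_iff_subtype (p := fun t => ext G t ≤ ext H t) measurableSet_halfOpen).2 ?_
  filter_upwards [h] with s hs
  rwa [ext_apply G s.2, ext_apply H s.2]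

/-- A measurable function between `lo` and `hi` is locally Henstock–Kurzweil integrable: its
excess over `lo` is dominated by the nonnegative function `hi - lo`, which is locally Lebesgue
integrable. -/
theorem locHK_of_ae_le {lo hi : Dlc a b} (hle : lo ≤ hi) {H : HalfOpen a b → ℝ}
    (hH : Measurable H) (hlo : lo.1 ≤ᵐ[lebesgue a b] H) (hhi : H ≤ᵐ[lebesgue a b] hi.1) :
    LocHK H := by
  intro c d hcd hsub
  have hsub' : Set.Ioc c d ⊆ HalfOpen a b := Set.Ioc_subset_Icc_self.trans hsub
  have hres : volume.restrict (Set.Ioc c d) ≤ volume.restrict (HalfOpen a b) :=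
    Measure.restrict_mono hsub' le_rfl
  obtain ⟨I, hI⟩ := lo.2.1.2.1 c d hcd hsub
  obtain ⟨J, hJ⟩ := hi.2.1.2.1 c d hcd hsub
  have hmlo := (aemeasurable_ext lo.aemeasurable).mono_measure hres
  have hmhi := (aemeasurable_ext hi.aemeasurable).mono_measure hres
  have hmH := (aemeasurable_ext hH.aemeasurable).mono_measure hres
  have hgap : IntegrableOn (fun t => ext hi.1 t - ext lo.1 t) (Set.Ioc c d) := by
    refine (hJ.sub hI).integrableOn (hmhi.sub hmlo) fun t ht => sub_nonneg.2 ?_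
    rw [ext_apply _ (hsub ht), ext_apply _ (hsub ht)]
    exact hle _
  have hexc : IntegrableOn (fun t => ext H t - ext lo.1 t) (Set.Ioc c d) := by
    refine Integrable.mono' hgap (hmH.sub hmlo).aestronglyMeasurable ?_
    filter_upwards [ae_mono hres (ae_restrict_ext_le hlo), ae_mono hres (ae_restrict_ext_le hhi)]
      with t h1 h2
    rw [Real.norm_of_nonneg (sub_nonneg.2 h1)]
    linarith
  exact ⟨_, (hI.add (hasHKIntegral_of_integrableOn hcd hexc)).congr fun t _ =>
    add_sub_cancel _ _⟩

theorem exists_isGLB_measInterval {lo hi : Dlc a b} (hle : lo ≤ hi)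
    (S : Set (MeasInterval lo hi)) : ∃ u, IsGLB S u := by
  choose R hRm hR using fun u : MeasInterval lo hi => u.2.1
  have hRlo (u : MeasInterval lo hi) : lo.1 ≤ᵐ[lebesgue a b] R u := by
    have h : lo.toHKloc.1 ≤ u.1.1 := u.2.2.1
    rw [hR u] at h
    exact Germ.coe_le.1 h
  have hRhi (u : MeasInterval lo hi) : R u ≤ᵐ[lebesgue a b] hi.1 := by
    have h : u.1.1 ≤ hi.toHKloc.1 := u.2.2.2
    rw [hR u] at h
    exact Germ.coe_le.1 h
  have hRle {u v : MeasInterval lo hi} : u ≤ v ↔ R u ≤ᵐ[lebesgue a b] R v := by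
    change u.1.1 ≤ v.1.1 ↔ _
    rw [hR u, hR v]
    exact Germ.coe_le
  -- adjoining the greatest element makes the family nonempty
  let top : MeasInterval lo hi :=
    ⟨hi.toHKloc, hi.isMeasurable_toHKloc, Dlc.toHKloc_mono hle, le_rfl⟩
  obtain ⟨L, hLm, hL⟩ := lo.aemeasurable
  let w (u : MeasInterval lo hi) (s : HalfOpen a b) : ENNReal := ENNReal.ofReal (R u s - L s)
  obtain ⟨d, hdm, hdle, hdge⟩ := exists_measurable_ae_isGLB (lebesgue a b) (w '' insert top S)
    (Set.mem_image_of_mem w (Set.mem_insert top S))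
    (Eventually.of_forall fun s => ENNReal.ofReal_ne_top)
  have hd (u) (hu : u ∈ insert top S) : ∀ᵐ s ∂lebesgue a b, L s + (d s).toReal ≤ R u s := by
    filter_upwards [hdle _ (Set.mem_image_of_mem w hu), hRlo u, hL] with s h1 h2 h3
    have := ENNReal.toReal_le_of_le_ofReal (by linarith) h1
    linarith
  have hHm : Measurable fun s => L s + (d s).toReal := hLm.add hdm.ennreal_toReal
  have hlo : lo.1 ≤ᵐ[lebesgue a b] fun s => L s + (d s).toReal := by
    filter_upwards [hL] with s hs
    rw [hs]
    exact le_add_of_nonneg_right ENNReal.toReal_nonneg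
  have hhi : (fun s => L s + (d s).toReal) ≤ᵐ[lebesgue a b] hi.1 :=
    EventuallyLE.trans (hd top (Set.mem_insert _ _)) (hRhi top)
  let g : MeasInterval lo hi := ⟨⟨Germ.ofFun fun s => L s + (d s).toReal, _,
    locHK_of_ae_le hle hHm hlo hhi, rfl⟩, ⟨_, hHm, rfl⟩, Germ.coe_le.2 hlo, Germ.coe_le.2 hhi⟩
  have hg : R g =ᵐ[lebesgue a b] fun s => L s + (d s).toReal := Germ.coe_eq.1 (hR g).symm
  refine ⟨g, fun u hu => hRle.2 (hg.le.trans (hd u (Set.mem_insert_of_mem _ hu))),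
    fun v hv => hRle.2 (EventuallyLE.trans ?_ hg.symm.le)⟩
  have hvd : w v ≤ᵐ[lebesgue a b] d := by
    refine hdge _ ((hRm v).sub hLm).ennreal_ofReal ?_
    rintro _ ⟨u, hu, rfl⟩
    have hvu : R v ≤ᵐ[lebesgue a b] R u := by
      rcases hu with rfl | hu
      · exact hRle.1 (v.2.2.2 : v ≤ top)
      · exact hRle.1 (hv hu)
    filter_upwards [hvu] with s hs
    exact ENNReal.ofReal_le_ofReal (sub_le_sub_right hs _)
  filter_upwards [hvd, hdle _ (Set.mem_image_of_mem w (Set.mem_insert top S))] with s h1 h2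
  have := (ENNReal.ofReal_le_iff_le_toReal (h2.trans_lt ENNReal.ofReal_lt_top).ne).1 h1
  linarith

/-- The order interval of measurable classes is a complete lattice. -/
@[reducible] noncomputable def completeLatticeMeasInterval {lo hi : Dlc a b} (hle : lo ≤ hi) :
    CompleteLattice (MeasInterval lo hi) :=
  letI : InfSet (MeasInterval lo hi) := ⟨fun S => (exists_isGLB_measInterval hle S).choose⟩
  completeLatticeOfInf _ fun S => (exists_isGLB_measInterval hle S).choose_spec

/-! ### The integral operator of the system -/

theorem IsIncreasing.exists_primitive {f : Fin m → (Fin m → HKloc a b) → AD a b}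
    (hf : IsIncreasing f) (i : Fin m) (u : Fin m → HKloc a b) :
    ∃ F : Dlc a b, IsNormalizedPrimitive (f i u) F := by
  obtain ⟨F, -, hF, -⟩ := hf i u u le_rfl
  exact ⟨F, hF⟩

/-- The operator `u ↦ c + F(f(u))`, where `F` denotes the normalized primitive. It is defined on
all of `HK_loc([a,b))^m` and takes values in `D^{lc}([a,b))^m`. -/
noncomputable def solutionOperator (hab : (a : EReal) < b)
    {f : Fin m → (Fin m → HKloc a b) → AD a b} (hf : IsIncreasing f) (c : Fin m → ℝ)
    (u : Fin m → HKloc a b) (i : Fin m) : Dlc a b :=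
  (hf.exists_primitive i u).choose.addConst hab (c i)

theorem exists_solutionOperator_eq (hab : (a : EReal) < b)
    {f : Fin m → (Fin m → HKloc a b) → AD a b} (hf : IsIncreasing f) (c : Fin m → ℝ)
    (u : Fin m → HKloc a b) (i : Fin m) : ∃ F : Dlc a b, IsNormalizedPrimitive (f i u) F ∧
      solutionOperator hab hf c u i = F.addConst hab (c i) :=
  ⟨_, (hf.exists_primitive i u).choose_spec, rfl⟩

theorem Dlc.addConst_le_addConst (hab : (a : EReal) < b) {Y Z : Dlc a b} (h : Y ≤ Z) {k l : ℝ}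
    (hkl : k ≤ l) : Y.addConst hab k ≤ Z.addConst hab l := fun s => add_le_add (h s) hkl

theorem solutionOperator_mono (hab : (a : EReal) < b)
    {f : Fin m → (Fin m → HKloc a b) → AD a b} (hf : IsIncreasing f) (c : Fin m → ℝ) :
    Monotone (solutionOperator hab hf c) := by
  intro u v huv i
  obtain ⟨F, hF, hFe⟩ := exists_solutionOperator_eq hab hf c u i
  obtain ⟨G, hG, hGe⟩ := exists_solutionOperator_eq hab hf c v i
  rw [hFe, hGe]
  exact Dlc.addConst_le_addConst hab ((hf i u v huv).le hab hF hG) le_rfl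

theorem IsSubsolution.le_solutionOperator (hab : (a : EReal) < b)
    {f : Fin m → (Fin m → HKloc a b) → AD a b} (hf : IsIncreasing f) {c : Fin m → ℝ}
    {y : Fin m → Dlc a b} (hy : IsSubsolution f c y) :
    y ≤ solutionOperator hab hf c fun j => (y j).toHKloc := by
  intro i
  obtain ⟨⟨g, hgy, hgf⟩, hc⟩ := hy i
  obtain ⟨F, hF, hFe⟩ := exists_solutionOperator_eq hab hf c (fun j => (y j).toHKloc) i
  obtain ⟨G, -, hG, -⟩ := id hgf
  rw [hFe, hG.eq_addConst hab hgy]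
  exact Dlc.addConst_le_addConst hab (hgf.le hab hG hF) hc

theorem IsSupersolution.solutionOperator_le (hab : (a : EReal) < b)
    {f : Fin m → (Fin m → HKloc a b) → AD a b} (hf : IsIncreasing f) {c : Fin m → ℝ}
    {y : Fin m → Dlc a b} (hy : IsSupersolution f c y) :
    solutionOperator hab hf c (fun j => (y j).toHKloc) ≤ y := by
  intro i
  obtain ⟨⟨g, hgy, hgf⟩, hc⟩ := hy i
  obtain ⟨F, hF, hFe⟩ := exists_solutionOperator_eq hab hf c (fun j => (y j).toHKloc) i
  obtain ⟨-, G, -, hG, -⟩ := id hgf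
  rw [hFe, hG.eq_addConst hab hgy]
  exact Dlc.addConst_le_addConst hab (hgf.le hab hF hG) hc

theorem isSolution_of_solutionOperator_eq (hab : (a : EReal) < b)
    {f : Fin m → (Fin m → HKloc a b) → AD a b} (hf : IsIncreasing f) {c : Fin m → ℝ}
    {y : Fin m → Dlc a b}
    (hy : solutionOperator hab hf c (fun j => (y j).toHKloc) = y) : IsSolution f c y := by
  intro i
  obtain ⟨F, hF, hFe⟩ := exists_solutionOperator_eq hab hf c (fun j => (y j).toHKloc) i
  rw [hy] at hFe
  rw [hFe, Dlc.initial_addConst, hF.initial_eq_zero, zero_add]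
  exact ⟨hF.1.addConst hab _, rfl⟩

theorem IsSolution.isSupersolution {f g : Fin m → (Fin m → HKloc a b) → AD a b}
    {c d : Fin m → ℝ} {y : Fin m → Dlc a b} (hy : IsSolution g d y)
    (hfg : ∀ i u, (f i u).Preceq (g i u)) (hcd : c ≤ d) : IsSupersolution f c y := fun i =>
  ⟨⟨_, (hy i).1, hfg i _⟩, (hcd i).trans (hy i).2.ge⟩

theorem IsSolution.isSubsolution {f g : Fin m → (Fin m → HKloc a b) → AD a b}
    {c d : Fin m → ℝ} {y : Fin m → Dlc a b} (hy : IsSolution f c y)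
    (hfg : ∀ i u, (f i u).Preceq (g i u)) (hcd : c ≤ d) : IsSubsolution g d y := fun i =>
  ⟨⟨_, (hy i).1, hfg i _⟩, (hy i).2.le.trans (hcd i)⟩

/-! ### Extremal solutions -/

/-- By the Knaster–Tarski theorem, the system has a solution below all its supersolutions in the
order interval, and a solution above all its subsolutions there. -/
theorem exists_extremal_solutions (hab : (a : EReal) < b) {ylo yhi : Fin m → Dlc a b}
    (hle : ylo ≤ yhi) {f : Fin m → (Fin m → HKloc a b) → AD a b} (hf : IsIncreasing f)
    {c : Fin m → ℝ} (hlo : IsSubsolution f c ylo) (hhi : IsSupersolution f c yhi) :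
    (∃ y ∈ solutionsIn f c ylo yhi, ∀ z ∈ Set.Icc ylo yhi, IsSupersolution f c z → y ≤ z) ∧
    ∃ y ∈ solutionsIn f c ylo yhi, ∀ z ∈ Set.Icc ylo yhi, IsSubsolution f c z → z ≤ y := by
  let (i : Fin m) : CompleteLattice (MeasInterval (ylo i) (yhi i)) :=
    completeLatticeMeasInterval (hle i)
  let Φ := solutionOperator hab hf c
  have hΦ : Monotone Φ := solutionOperator_mono hab hf c
  let ι (u : ∀ i, MeasInterval (ylo i) (yhi i)) (i : Fin m) : HKloc a b := (u i).1
  have hι : Monotone ι := fun u v huv i => huv i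
  have hmem (u : ∀ i, MeasInterval (ylo i) (yhi i)) : Φ (ι u) ∈ Set.Icc ylo yhi :=
    ⟨(hlo.le_solutionOperator hab hf).trans (hΦ fun i => (u i).2.2.1),
      (hΦ fun i => (u i).2.2.2).trans (hhi.solutionOperator_le hab hf)⟩
  let κ (z : Fin m → Dlc a b) (hz : z ∈ Set.Icc ylo yhi) (i : Fin m) :
      MeasInterval (ylo i) (yhi i) :=
    ⟨(z i).toHKloc, (z i).isMeasurable_toHKloc, Dlc.toHKloc_mono (hz.1 i),
      Dlc.toHKloc_mono (hz.2 i)⟩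
  let T : (∀ i, MeasInterval (ylo i) (yhi i)) →o (∀ i, MeasInterval (ylo i) (yhi i)) :=
    { toFun := fun u => κ (Φ (ι u)) (hmem u)
      monotone' := fun u v huv i => Dlc.toHKloc_mono (hΦ (hι huv) i) }
  have hsol (u : ∀ i, MeasInterval (ylo i) (yhi i)) (hu : T u = u) :
      Φ (ι u) ∈ solutionsIn f c ylo yhi := by
    refine ⟨hmem u, isSolution_of_solutionOperator_eq hab hf ?_⟩
    exact congrArg (fun v => Φ (ι v)) hu
  refine ⟨⟨_, hsol _ T.map_lfp, fun z hz hs => ?_⟩, ⟨_, hsol _ T.map_gfp, fun z hz hs => ?_⟩⟩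
  · have hz' := hs.solutionOperator_le hab hf
    have : T.lfp ≤ κ z hz := T.lfp_le fun i => Dlc.toHKloc_mono (hz' i)
    exact (hΦ (hι this)).trans hz'
  · have hz' := hs.le_solutionOperator hab hf
    have : κ z hz ≤ T.gfp := T.le_gfp fun i => Dlc.toHKloc_mono (hz' i)
    exact hz'.trans (hΦ (hι this))

end DistribCauchy

theorem theorem5p1 (a : ℝ) (b : EReal) (hab : (a : EReal) < b) (m : ℕ)
    (ylo yhi : Fin m → DistribCauchy.Dlc a b) (hle : ylo ≤ yhi) :
    -- existence of the smallest and of the greatest solution in the order interval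
    (∀ (f : Fin m → (Fin m → DistribCauchy.HKloc a b) → DistribCauchy.AD a b) (c : Fin m → ℝ),
      DistribCauchy.IsIncreasing f →
      DistribCauchy.IsSubsolution f c ylo → DistribCauchy.IsSupersolution f c yhi →
      (∃ y, IsLeast (DistribCauchy.solutionsIn f c ylo yhi) y) ∧
      (∃ y, IsGreatest (DistribCauchy.solutionsIn f c ylo yhi) y)) ∧
    -- monotone dependence of these solutions on the right-hand sides and the initial values
    (∀ (f g : Fin m → (Fin m → DistribCauchy.HKloc a b) → DistribCauchy.AD a b)
      (c d : Fin m → ℝ),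
      DistribCauchy.IsIncreasing f → DistribCauchy.IsIncreasing g →
      DistribCauchy.IsSubsolution f c ylo → DistribCauchy.IsSupersolution f c yhi →
      DistribCauchy.IsSubsolution g d ylo → DistribCauchy.IsSupersolution g d yhi →
      (∀ i u, (f i u).Preceq (g i u)) → c ≤ d →
      (∀ y z, IsLeast (DistribCauchy.solutionsIn f c ylo yhi) y →
        IsLeast (DistribCauchy.solutionsIn g d ylo yhi) z → y ≤ z) ∧
      (∀ y z, IsGreatest (DistribCauchy.solutionsIn f c ylo yhi) y →
        IsGreatest (DistribCauchy.solutionsIn g d ylo yhi) z → y ≤ z)) := by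
  refine ⟨fun f c hf hlo hhi => ?_, fun f g c d hf hg hflo hfhi hglo hghi hfg hcd => ?_⟩
  · obtain ⟨⟨y, hy, hyle⟩, ⟨z, hz, hzle⟩⟩ :=
      DistribCauchy.exists_extremal_solutions hab hle hf hlo hhi
    have hrefl : ∀ i u, (f i u).Preceq (f i u) := fun i u => hf i u u le_rfl
    exact ⟨⟨y, hy, fun v hv => hyle v hv.1 (hv.2.isSupersolution hrefl le_rfl)⟩,
      ⟨z, hz, fun v hv => hzle v hv.1 (hv.2.isSubsolution hrefl le_rfl)⟩⟩
  · obtain ⟨⟨y₀, hy₀, hy₀le⟩, -⟩ :=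
      DistribCauchy.exists_extremal_solutions hab hle hf hflo hfhi
    obtain ⟨-, ⟨z₀, hz₀, hz₀le⟩⟩ :=
      DistribCauchy.exists_extremal_solutions hab hle hg hglo hghi
    exact ⟨fun y z hy hz =>
        (hy.2 hy₀).trans (hy₀le z hz.1.1 (hz.1.2.isSupersolution hfg hcd)),
      fun y z hy hz =>
        (hz₀le y hy.1.1 (hy.1.2.isSubsolution hfg hcd)).trans (hz.2 hz₀)⟩
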